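/- Let $N\ge 3$, let $\Omega\subset\mathbb{R}^N$ be open and let $\psi:\Omega\to\mathbb{R}$ be smooth ($C^\infty$). Put $u=\nabla\psi$, and for $\xi\in\mathbb{S}^{N-1}$ and $x\in\Omega$ let $\chi(x,\xi)=1$ if $u(x)\cdot\xi>0$ and $\chi(x,\xi)=0$ if $u(x)\cdot\xi\le 0$. Assume that $u$ satisfies the kinetic formulation: for every $\xi\in\mathbb{S}^{N-1}$ and every $v\in\mathbb{R}^N$ with $v\cdot\xi=0$, one has $v\cdot\nabla_x\chi(\cdot,\xi)=0$ in the sense of distributions in $\Omega$, that is, $\int_\Omega \chi(x,\xi)\,v\cdot\nabla\varphi(x)\,dx=0$ for all $\varphi\in C_c^\infty(\Omega)$. Let $\alpha\in\mathbb{R}$ be such that $u$ vanishes nowhere on the level set $\{x\in\Omega:\psi(x)=\alpha\}$, and let $\mathcal{S}$ be a connected component of this level set. Then there exist an open set $\omega$ with $\mathcal{S}\subset\omega\subset\Omega$ and a $C^\infty$ diffeomorphism $F$ from an open interval $I\subset\mathbb{R}$ onto an open subset of $\mathbb{R}$ such that one of the following holds: 1. there is a point $P\in\mathbb{R}^N$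 such that $|x-P|\in I$ and $\psi(x)=F(|x-P|)$ for every $x\in\omega$; 2. there is a unit vector $\xi\in\mathbb{S}^{N-1}$ such that $x\cdot\xi\in I$ and $\psi(x)=F(x\cdot\xi)$ for every $x\in\omega$. -/

import Mathlib

open Set MeasureTheory
open scoped ContDiff Gradient

/-- For a vector field `u` and a direction `ξ`, the function `χ(·, ξ)`, equal to `1` where
`u(x) · ξ > 0` and to `0` where `u(x) · ξ ≤ 0`. -/
noncomputable def kineticChi {N : ℕ}
    (u : EuclideanSpace ℝ (Fin N) → EuclideanSpace ℝ (Fin N))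
    (ξ x : EuclideanSpace ℝ (Fin N)) : ℝ :=
  if 0 < inner ℝ (u x) ξ then 1 else 0

/-- The kinetic formulation in `Ω`: for every unit vector `ξ` and every `v` orthogonal to `ξ`,
`v · ∇ₓ χ(·, ξ) = 0` in the sense of distributions in `Ω`, that is,
`∫_Ω χ(x, ξ) (v · ∇φ(x)) dx = 0` for every real-valued `φ ∈ C_c^∞(Ω)`. -/
def KineticFormulation {N : ℕ} (Ω : Set (EuclideanSpace ℝ (Fin N)))
    (u : EuclideanSpace ℝ (Fin N) → EuclideanSpace ℝ (Fin N)) : Prop :=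
  ∀ ξ v : EuclideanSpace ℝ (Fin N), ‖ξ‖ = 1 → inner ℝ v ξ = 0 →
    ∀ φ : EuclideanSpace ℝ (Fin N) → ℝ,
      ContDiff ℝ ∞ φ → HasCompactSupport φ → tsupport φ ⊆ Ω →
        ∫ x in Ω, kineticChi u ξ x * fderiv ℝ φ x v = 0

/-- `F` restricts to a smooth diffeomorphism of the open interval `I` onto an open set `J` of the
real line (automatically an interval): it is a smooth bijection of `I` onto `J` with a smooth
inverse `G`. -/
def IsIntervalDiffeo (F : ℝ → ℝ) (I : Set ℝ) : Prop :=
  IsOpen I ∧ I.OrdConnected ∧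
    ∃ (J : Set ℝ) (G : ℝ → ℝ), IsOpen J ∧
      ContDiffOn ℝ ∞ F I ∧ ContDiffOn ℝ ∞ G J ∧
      MapsTo F I J ∧ MapsTo G J I ∧ LeftInvOn G F I ∧ RightInvOn G F J

/-! Mollifying `χ(·, ξ)` turns the distributional identity into a pointwise one: if the segment from
y to z lies in Ω, z - y ⊥ ξ and u(y)·ξ > 0, then u(z)·ξ ≥ 0 (`KineticFormulation.inner_nonneg`).
Letting ξ vary in the orthogonal complement of z - y forces u(z) into span{u(y), z - y} unless u(y)
is parallel to z - y: the lines carried by u at y and z are coplanar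
(`KineticFormulation.mem_span_pair`).

In dimension at least 3, pairwise coplanar lines of a continuous field are all parallel or all
concurrent. Two nonparallel ones meet at some P; for x off their plane, the line at x lies in the
two planes joining x to them, which share only the line Px (`CoplanarOn.radial`). The alternative
and its P or direction ξ are fixed by the germ of u, so they propagate along the connected set S.

Hence ψ is constant on small pieces of spheres or hyperplanes, so near each point of S it is f ∘ ρ
with ρ = |x - P| or x·ξ and f' ≠ 0. As f is locally injective and ψ = α on S, ρ is constant on S;
all the local f then share one germ, which gives F. -/

open Filter Topology

/-! ### From the kinetic formulation to a pointwise sign condition -/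

/-- The mollification of `χ(·, ξ)` by an even bump is constant along a segment orthogonal to `ξ`
whose `ε`-neighbourhood lies in `Ω`. -/
theorem KineticFormulation.convolution_eq {N : ℕ} {Ω : Set (EuclideanSpace ℝ (Fin N))}
    (hΩ : IsOpen Ω) {u : EuclideanSpace ℝ (Fin N) → EuclideanSpace ℝ (Fin N)}
    (hu : ContinuousOn u Ω) (hkin : KineticFormulation Ω u)
    {ξ v y : EuclideanSpace ℝ (Fin N)} (hξ : ‖ξ‖ = 1) (hv : inner ℝ v ξ = 0)
    (η : ContDiffBump (0 : EuclideanSpace ℝ (Fin N)))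
    (hη : ∀ s ∈ Icc (0 : ℝ) 1, Metric.closedBall (y + s • v) η.rOut ⊆ Ω) :
    ∫ x in {x ∈ Ω | 0 < inner ℝ (u x) ξ}, η (y + v - x) =
      ∫ x in {x ∈ Ω | 0 < inner ℝ (u x) ξ}, η (y - x) := by
  set A := {x ∈ Ω | 0 < inner ℝ (u x) ξ} with hA
  have hAo : IsOpen A := by
    have h1 : ContinuousOn (fun x => inner ℝ (u x) ξ) Ω := hu.inner continuousOn_const
    exact h1.isOpen_inter_preimage hΩ isOpen_Ioi
  have hAm := hAo.measurableSet
  set g : EuclideanSpace ℝ (Fin N) → ℝ := A.indicator 1 with hg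
  have hgl : LocallyIntegrable g volume :=
    (locallyIntegrable_const (1 : ℝ)).indicator hAm
  set L := ContinuousLinearMap.lsmul ℝ ℝ (E := ℝ)
  set T := convolution g η L volume with hT
  have hTint : ∀ (f : EuclideanSpace ℝ (Fin N) → ℝ) p,
      convolution g f L volume p = ∫ x in A, f (p - x) := by
    intro f p
    rw [convolution_def, ← integral_indicator hAm]
    refine integral_congr_ae (Eventually.of_forall fun x => ?_)
    by_cases hx : x ∈ A <;> simp [hg, L, hx]
  have hsm : ContDiff ℝ ∞ (η : EuclideanSpace ℝ (Fin N) → ℝ) := η.contDiff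
  have hder : ∀ p, HasFDerivAt T (convolution g (fderiv ℝ η) (L.precompR _) volume p) p :=
    fun p => η.hasCompactSupport.hasFDerivAt_convolution_right L hgl (hsm.of_le (by simp)) p
  -- Tested on x ↦ η (p - x), the kinetic formulation says that the `v`-derivative of the
  -- mollification vanishes at p.
  have hzero : ∀ p, Metric.closedBall p η.rOut ⊆ Ω →
      convolution g (fderiv ℝ η) (L.precompR _) volume p v = 0 := by
    intro p hp
    rw [convolution_precompR_apply L hgl (η.hasCompactSupport.fderiv ℝ)
      (hsm.continuous_fderiv (by simp)), hTint]
    have hφd : ∀ x, fderiv ℝ (fun x => η (p - x)) x v = - fderiv ℝ η (p - x) v := by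
      intro x
      have h1 : HasFDerivAt (fun x => p - x) (-ContinuousLinearMap.id ℝ _) x :=
        (hasFDerivAt_id x).const_sub p
      have h2 : HasFDerivAt η (fderiv ℝ η (p - x)) (p - x) :=
        (hsm.differentiable (by simp) _).hasFDerivAt
      have h3 := h2.comp x h1
      have h4 : fderiv ℝ (fun x => η (p - x)) x = _ := h3.fderiv
      rw [h4]; simp
    have hsupp : tsupport (fun x => η (p - x)) ⊆ Metric.closedBall p η.rOut := by
      refine closure_minimal (fun x hx => ?_) Metric.isClosed_closedBall
      have : p - x ∈ Function.support η := hx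
      rw [η.support_eq] at this
      simp only [Metric.mem_ball, dist_zero_right] at this
      rw [Metric.mem_closedBall, dist_comm, dist_eq_norm]
      exact this.le
    have h := hkin ξ v hξ hv (fun x => η (p - x)) (hsm.comp (contDiff_const.sub contDiff_id))
      (HasCompactSupport.of_support_subset_isCompact (isCompact_closedBall p η.rOut)
        ((subset_tsupport _).trans hsupp)) (hsupp.trans hp)
    have h5 : ∫ x in Ω, kineticChi u ξ x * fderiv ℝ (fun x => η (p - x)) x v =
        ∫ x in A, - fderiv ℝ η (p - x) v := by
      rw [← integral_indicator hΩ.measurableSet, ← integral_indicator hAm]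
      refine integral_congr_ae (Eventually.of_forall fun x => ?_)
      by_cases hx : x ∈ Ω <;> by_cases hx' : 0 < inner ℝ (u x) ξ <;>
        simp [hA, hx, hx', kineticChi, hφd, Set.indicator]
    rw [h5, integral_neg, neg_eq_zero] at h
    exact h
  have hline : ∀ s : ℝ, HasDerivAt (fun s : ℝ => T (y + s • v))
      (convolution g (fderiv ℝ η) (L.precompR _) volume (y + s • v) v) s := by
    intro s
    have h1 : HasDerivAt (fun s : ℝ => y + s • v) v s := by
      simpa using ((hasDerivAt_id s).smul_const v).const_add y
    exact (hder (y + s • v)).comp_hasDerivAt s h1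
  have hconst := constant_of_has_deriv_right_zero (f := fun s : ℝ => T (y + s • v)) (a := 0) (b := 1)
    (fun s _ => (hline s).continuousAt.continuousWithinAt)
    (fun s hs => by
      have := hline s
      rw [hzero _ (hη s ⟨hs.1, hs.2.le⟩)] at this
      exact this.hasDerivWithinAt) 1 ⟨zero_le_one, le_rfl⟩
  simp only [one_smul, zero_smul, add_zero, hT, hTint] at hconst
  exact hconst

/-- If u(z)·ξ < 0, a mollification at small scale has full mass at y and is zero at z, yet it is
constant along the segment. Where u(z)·ξ = 0, χ may equal 1 arbitrarily close to z, so only the weak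
inequality results. -/
theorem KineticFormulation.inner_nonneg_of_unit {N : ℕ} {Ω : Set (EuclideanSpace ℝ (Fin N))}
    (hΩ : IsOpen Ω) {u : EuclideanSpace ℝ (Fin N) → EuclideanSpace ℝ (Fin N)}
    (hu : ContinuousOn u Ω) (hkin : KineticFormulation Ω u)
    {ξ y z : EuclideanSpace ℝ (Fin N)} (hyz : segment ℝ y z ⊆ Ω) (hξ : ‖ξ‖ = 1)
    (hperp : inner ℝ (z - y) ξ = 0) (hy : 0 < inner ℝ (u y) ξ) : 0 ≤ inner ℝ (u z) ξ := by
  by_contra! hz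
  have hcont : ContinuousOn (fun x => inner ℝ (u x) ξ) Ω := hu.inner continuousOn_const
  have hyΩ := hyz (left_mem_segment ℝ y z)
  have hzΩ := hyz (right_mem_segment ℝ y z)
  obtain ⟨ε₁, hε₁, h₁⟩ : ∃ ε > 0, Metric.cthickening ε (segment ℝ y z) ⊆ Ω := by
    have hc : IsCompact (segment ℝ y z) := by
      rw [← convexHull_pair]
      exact (Set.toFinite _).isCompact_convexHull (𝕜 := ℝ)
    exact hc.exists_cthickening_subset_open hΩ hyz
  obtain ⟨ε₂, hε₂, h₂⟩ := Metric.eventually_nhds_iff_ball.1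
    ((hΩ.eventually_mem hyΩ).and ((hcont.continuousAt (hΩ.mem_nhds hyΩ)).eventually
      (lt_mem_nhds hy)))
  obtain ⟨ε₃, hε₃, h₃⟩ := Metric.eventually_nhds_iff_ball.1
    ((hcont.continuousAt (hΩ.mem_nhds hzΩ)).eventually (gt_mem_nhds hz))
  obtain ⟨ε, hε, hlt⟩ := exists_between (lt_min hε₁ (lt_min hε₂ hε₃))
  simp only [lt_min_iff] at hlt
  let η : ContDiffBump (0 : EuclideanSpace ℝ (Fin N)) := ⟨ε / 2, ε, by positivity, by linarith⟩
  have hηsupp : ∀ x, η x ≠ 0 → ‖x‖ < ε := by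
    intro x hx
    have : x ∈ Function.support η := hx
    rw [η.support_eq] at this
    simpa using this
  have hkey := hkin.convolution_eq hΩ hu (y := y) hξ hperp η (by
    intro s hs
    refine Subset.trans ?_ h₁
    refine (Metric.closedBall_subset_cthickening (E := segment ℝ y z) ?_ _).trans
      (Metric.cthickening_mono hlt.1.le _)
    rw [segment_eq_image']
    exact ⟨s, hs, rfl⟩)
  rw [add_sub_cancel] at hkey
  have hzero : ∫ x in {x ∈ Ω | 0 < inner ℝ (u x) ξ}, η (z - x) = 0 := by
    refine setIntegral_eq_zero_of_forall_eq_zero fun x hx => ?_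
    by_contra hne
    have h4 := hηsupp _ hne
    have := h₃ x (by
      rw [Metric.mem_ball, dist_comm, dist_eq_norm]
      exact h4.trans hlt.2.2)
    exact lt_asymm this hx.2
  have hone : ∫ x in {x ∈ Ω | 0 < inner ℝ (u x) ξ}, η (y - x) = ∫ x, η (y - x) := by
    refine setIntegral_eq_integral_of_forall_compl_eq_zero fun x hx => ?_
    by_contra hne
    have h4 := hηsupp _ hne
    exact hx (h₂ x (by
      rw [Metric.mem_ball, dist_comm, dist_eq_norm]
      exact h4.trans hlt.2.1))
  rw [hzero, hone, integral_sub_left_eq_self (fun x => η x)] at hkey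
  exact absurd hkey (η.integral_pos (μ := volume)).ne

theorem KineticFormulation.inner_nonneg {N : ℕ} {Ω : Set (EuclideanSpace ℝ (Fin N))}
    (hΩ : IsOpen Ω) {u : EuclideanSpace ℝ (Fin N) → EuclideanSpace ℝ (Fin N)}
    (hu : ContinuousOn u Ω) (hkin : KineticFormulation Ω u)
    {ξ y z : EuclideanSpace ℝ (Fin N)} (hyz : segment ℝ y z ⊆ Ω)
    (hperp : inner ℝ (z - y) ξ = 0) (hy : 0 < inner ℝ (u y) ξ) : 0 ≤ inner ℝ (u z) ξ := by
  have hξ : ξ ≠ 0 := by rintro rfl; simp at hy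
  have hpos : 0 < ‖ξ‖⁻¹ := inv_pos.2 (norm_pos_iff.2 hξ)
  have h := hkin.inner_nonneg_of_unit hΩ hu (ξ := ‖ξ‖⁻¹ • ξ) hyz (norm_smul_inv_norm hξ)
    (by rw [inner_smul_right, hperp, mul_zero])
    (by rw [inner_smul_right]; exact mul_pos hpos hy)
  rw [inner_smul_right] at h
  exact (mul_nonneg_iff_of_pos_left hpos).1 h

/-! ### Coplanarity from the sign condition -/

section InnerProductSpace

variable {E : Type*} [NormedAddCommGroup E] [InnerProductSpace ℝ E] [FiniteDimensional ℝ E]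

theorem Submodule.exists_orthogonal_inner_pos_of_notMem {K : Submodule ℝ E} {a : E} (ha : a ∉ K) :
    ∃ p : E, (∀ k ∈ K, inner ℝ k p = 0) ∧ 0 < inner ℝ a p := by
  obtain ⟨k, hk, p, hp, rfl⟩ := K.exists_add_mem_mem_orthogonal a
  refine ⟨p, fun k' hk' => hp k' hk', ?_⟩
  rw [inner_add_left, hp k hk, zero_add, real_inner_self_pos]
  rintro rfl
  exact ha (by simpa using hk)

/-- Otherwise some q orthogonal to a and d has b·q > 0. Subtracting a multiple of q from an
admissible ξ keeps it admissible and brings b·ξ down to -1. -/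
theorem mem_span_pair_of_forall_inner_nonneg {a b d : E} (ha : a ∉ Submodule.span ℝ {d})
    (h : ∀ ξ : E, inner ℝ d ξ = 0 → 0 < inner ℝ a ξ → 0 ≤ inner ℝ b ξ) :
    b ∈ Submodule.span ℝ {a, d} := by
  by_contra hb
  obtain ⟨p, hp, hap⟩ := Submodule.exists_orthogonal_inner_pos_of_notMem ha
  obtain ⟨q, hq, hbq⟩ := Submodule.exists_orthogonal_inner_pos_of_notMem hb
  have hdp := hp d (Submodule.mem_span_singleton_self d)
  have haq := hq a (Submodule.subset_span (by simp))
  have hdq := hq d (Submodule.subset_span (by simp))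
  have := h (p - ((inner ℝ b p + 1) / inner ℝ b q) • q)
    (by simp [inner_sub_right, inner_smul_right, hdp, hdq])
    (by simpa [inner_sub_right, inner_smul_right, haq] using hap)
  rw [inner_sub_right, inner_smul_right, div_mul_cancel₀ _ hbq.ne'] at this
  linarith

end InnerProductSpace

/-- The lines through `y` and `z` with directions `u y` and `u z` are coplanar. -/
theorem KineticFormulation.mem_span_pair {N : ℕ} {Ω : Set (EuclideanSpace ℝ (Fin N))}
    (hΩ : IsOpen Ω) {u : EuclideanSpace ℝ (Fin N) → EuclideanSpace ℝ (Fin N)}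
    (hu : ContinuousOn u Ω) (hkin : KineticFormulation Ω u)
    {y z : EuclideanSpace ℝ (Fin N)} (hyz : segment ℝ y z ⊆ Ω)
    (h : u y ∉ Submodule.span ℝ {z - y}) : u z ∈ Submodule.span ℝ {u y, z - y} :=
  mem_span_pair_of_forall_inner_nonneg h fun _ h₁ h₂ => hkin.inner_nonneg hΩ hu hyz h₁ h₂

/-! ### Fields of pairwise coplanar lines -/

section CoplanarLines

variable {E : Type*} [NormedAddCommGroup E] [InnerProductSpace ℝ E]

/-- On `B` the vector field `u` is continuous and nowhere zero, and the lines spanned by `u` at any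
two points of `B` are coplanar. -/
structure CoplanarOn (u : E → E) (B : Set E) : Prop where
  isOpen : IsOpen B
  continuousOn : ContinuousOn u B
  ne_zero : ∀ x ∈ B, u x ≠ 0
  mem_span_pair : ∀ y ∈ B, ∀ z ∈ B, u y ∉ Submodule.span ℝ {z - y} →
    u z ∈ Submodule.span ℝ {u y, z - y}

theorem exists_notMem_span_pair (hE : 3 ≤ Module.finrank ℝ E) (a b : E) :
    ∃ w, w ∉ Submodule.span ℝ {a, b} := by
  classical
  by_contra! h
  have h1 : Submodule.span ℝ {a, b} = ⊤ := Submodule.eq_top_iff'.2 h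
  have h2 := finrank_span_finset_le_card (R := ℝ) ({a, b} : Finset E)
  have h3 : ({a, b} : Finset E).card ≤ 2 := Finset.card_le_two
  rw [Finset.coe_pair, Set.finrank, h1, finrank_top] at h2
  omega

/-- The planes span{a, X} and span{b, X} meet only in the line of X. In the application X = x - P
and s • a = y - P, so that X - s • a = x - y. -/
theorem mem_span_singleton_of_mem_span_pair_sub {a b c X : E}
    (hab : LinearIndependent ℝ ![a, b]) (hX : X ∉ Submodule.span ℝ {a, b}) {s t : ℝ}
    (ha : c ∈ Submodule.span ℝ {a, X - s • a}) (hb : c ∈ Submodule.span ℝ {b, X - t • b}) :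
    c ∈ Submodule.span ℝ {X} := by
  rw [LinearIndependent.pair_iff] at hab
  rw [Submodule.mem_span_pair] at ha hb hX
  obtain ⟨α, μ, rfl⟩ := ha
  obtain ⟨β, ν, h⟩ := hb
  have h1 : μ = ν := by
    by_contra hne
    have hne' : μ - ν ≠ 0 := sub_ne_zero.2 hne
    refine hX ⟨(μ * s - α) / (μ - ν), (β - ν * t) / (μ - ν), ?_⟩
    have h2 : (μ - ν) • X = (μ * s - α) • a + (β - ν * t) • b := by
      linear_combination (norm := module) -h
    rw [← inv_smul_smul₀ hne' X, h2]
    module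
  subst h1
  have h2 := hab (α - μ * s) (-(β - μ * t)) (by linear_combination (norm := module) -h)
  rw [Submodule.mem_span_singleton]
  exact ⟨μ, by linear_combination (norm := module) (-h2.1) • a⟩

namespace CoplanarOn

variable {u : E → E} {B : Set E}

theorem mem_span_sub_of_notMem (h : CoplanarOn u B) {y z x P : E} (hy : y ∈ B) (hz : z ∈ B)
    (hx : x ∈ B) (hli : LinearIndependent ℝ ![u y, u z])
    (hyP : y - P ∈ Submodule.span ℝ {u y}) (hzP : z - P ∈ Submodule.span ℝ {u z})
    (hxP : x - P ∉ Submodule.span ℝ {u y, u z}) : u x ∈ Submodule.span ℝ {x - P} := by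
  have key : ∀ y ∈ B, ∀ s : ℝ, s • u y = y - P → x - P ∉ Submodule.span ℝ {u y} →
      u x ∈ Submodule.span ℝ {u y, (x - P) - s • u y} := by
    intro y hy s hs hn
    have hxy : x - P - s • u y = x - y := by rw [hs]; abel
    rw [hxy]
    refine h.mem_span_pair y hy x hx fun hmem => hn ?_
    obtain ⟨k, hk⟩ := Submodule.mem_span_singleton.1 hmem
    have hk0 : k ≠ 0 := by
      rintro rfl
      exact h.ne_zero y hy (by rw [← hk, zero_smul])
    rw [Submodule.mem_span_singleton]
    refine ⟨k⁻¹ + s, ?_⟩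
    have h3 : k⁻¹ • u y = x - y := by rw [← hk, inv_smul_smul₀ hk0]
    rw [add_smul, h3, hs]; abel
  obtain ⟨s, hs⟩ := Submodule.mem_span_singleton.1 hyP
  obtain ⟨t, ht⟩ := Submodule.mem_span_singleton.1 hzP
  exact mem_span_singleton_of_mem_span_pair_sub hli hxP
    (key y hy s hs fun hh => hxP (Submodule.span_mono (by simp) hh))
    (key z hz t ht fun hh => hxP (Submodule.span_mono (by simp) hh))

/-- What remains is x in the plane through P. Approaching x along a direction w transversal to that
plane gives, by continuity, u x ∈ span{x - P, w}; varying w removes the w component. -/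
theorem radial [FiniteDimensional ℝ E] (hE : 3 ≤ Module.finrank ℝ E) (h : CoplanarOn u B)
    {y z P : E} (hy : y ∈ B) (hz : z ∈ B) (hli : LinearIndependent ℝ ![u y, u z])
    (hyP : y - P ∈ Submodule.span ℝ {u y}) (hzP : z - P ∈ Submodule.span ℝ {u z})
    {x : E} (hx : x ∈ B) : u x ∈ Submodule.span ℝ {x - P} := by
  by_cases hxP : x - P ∈ Submodule.span ℝ {u y, u z}
  swap
  · exact h.mem_span_sub_of_notMem hy hz hx hli hyP hzP hxP
  have key : ∀ w ∉ Submodule.span ℝ {u y, u z}, u x ∈ Submodule.span ℝ {x - P, w} := by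
    intro w hw
    have hline : Tendsto (fun t : ℝ => x + t • w) (𝓝[≠] 0) (𝓝 x) := by
      have : Continuous fun t : ℝ => x + t • w := by fun_prop
      simpa using (this.tendsto 0).mono_left nhdsWithin_le_nhds
    have hlim : Tendsto (fun t : ℝ => u (x + t • w)) (𝓝[≠] 0) (𝓝 (u x)) :=
      (h.continuousOn.continuousAt (h.isOpen.mem_nhds hx)).tendsto.comp hline
    refine (Submodule.closed_of_finiteDimensional _).mem_of_tendsto hlim ?_
    filter_upwards [hline.eventually (h.isOpen.mem_nhds hx), self_mem_nhdsWithin] with t ht ht0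
    have h1 := h.mem_span_sub_of_notMem hy hz ht hli hyP hzP (fun hmem => hw ?_)
    · obtain ⟨c, hc⟩ := Submodule.mem_span_singleton.1 h1
      exact Submodule.mem_span_pair.2 ⟨c, c * t, by rw [← hc]; module⟩
    · have h2 : t • w ∈ Submodule.span ℝ {u y, u z} := by
        have h3 := Submodule.sub_mem _ hmem hxP
        have h4 : x + t • w - P - (x - P) = t • w := by abel
        rwa [h4] at h3
      exact (Submodule.smul_mem_iff _ ht0).1 h2
  obtain ⟨w, hw⟩ := exists_notMem_span_pair hE (u y) (u z)
  have hw' : ∀ a ∈ Submodule.span ℝ {u y, u z}, w + a ∉ Submodule.span ℝ {u y, u z} :=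
    fun a ha hmem => hw ((Submodule.add_mem_iff_left _ ha).1 hmem)
  -- Replacing w by w + a leaves its coefficient β unchanged, as w is off the plane. So β • a is a
  -- multiple of x - P for each a in the plane, and two independent choices of a force β = 0.
  have key' : ∀ {α β : ℝ}, α • (x - P) + β • w = u x → ∀ a ∈ Submodule.span ℝ {u y, u z},
      ∃ k : ℝ, β • a = k • (x - P) := by
    intro α β hαβ a ha
    obtain ⟨α', β', h'⟩ := Submodule.mem_span_pair.1 (key _ (hw' a ha))
    have hβ : β' = β := by
      by_contra hne
      have hne' : β - β' ≠ 0 := sub_ne_zero.2 (Ne.symm hne)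
      refine hw ((Submodule.smul_mem_iff _ hne').1 ?_)
      have h2 : (β - β') • w = (α' - α) • (x - P) + β' • a := by
        linear_combination (norm := module) hαβ - h'
      rw [h2]
      exact Submodule.add_mem _ (Submodule.smul_mem _ _ hxP) (Submodule.smul_mem _ _ ha)
    subst hβ
    exact ⟨α - α', by linear_combination (norm := module) h' - hαβ⟩
  obtain ⟨α, β, hαβ⟩ := Submodule.mem_span_pair.1 (key w hw)
  obtain ⟨k, hk⟩ := key' hαβ (u y) (Submodule.subset_span (by simp))
  obtain ⟨l, hl⟩ := key' hαβ (u z) (Submodule.subset_span (by simp))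
  rw [LinearIndependent.pair_iff] at hli
  have hlk := hli (l * β) (-(k * β)) (by
    have : (l * β) • u y + (-(k * β)) • u z = l • (β • u y) - k • (β • u z) := by module
    rw [this, hk, hl]; module)
  have hβ : β = 0 := by
    by_contra hβ
    have hl0 : l = 0 := (mul_eq_zero.1 hlk.1).resolve_right hβ
    rw [hl0, zero_smul] at hl
    exact h.ne_zero z hz ((smul_eq_zero.1 hl).resolve_left hβ)
  rw [hβ, zero_smul, add_zero] at hαβ
  exact Submodule.mem_span_singleton.2 ⟨α, hαβ⟩

/-- Coplanar lines with independent directions meet: at z if z is on the line through y; otherwise u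
z = l • u y + μ • (z - y) with μ ≠ 0 by independence, and this is solved for the common point. -/
theorem exists_center (h : CoplanarOn u B) {y z : E} (hy : y ∈ B) (hz : z ∈ B)
    (hli : LinearIndependent ℝ ![u y, u z]) :
    ∃ P, y - P ∈ Submodule.span ℝ {u y} ∧ z - P ∈ Submodule.span ℝ {u z} := by
  simp only [Submodule.mem_span_singleton]
  by_cases hyz : u y ∈ Submodule.span ℝ {z - y}
  · obtain ⟨k, hk⟩ := Submodule.mem_span_singleton.1 hyz
    have hk0 : k ≠ 0 := by
      rintro rfl
      exact h.ne_zero y hy (by rw [← hk, zero_smul])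
    refine ⟨z, ⟨-k⁻¹, ?_⟩, 0, by simp⟩
    rw [← hk, neg_smul, inv_smul_smul₀ hk0]; abel
  · obtain ⟨l, μ, hμ⟩ := Submodule.mem_span_pair.1 (h.mem_span_pair y hy z hz hyz)
    have hμ0 : μ ≠ 0 := by
      rintro rfl
      rw [zero_smul, add_zero] at hμ
      rw [LinearIndependent.pair_iff' (h.ne_zero y hy)] at hli
      exact hli l hμ
    refine ⟨z - μ⁻¹ • u z, ⟨μ⁻¹ * l, ?_⟩, μ⁻¹, by abel⟩
    rw [← hμ, smul_add, inv_smul_smul₀ hμ0, mul_smul]; abel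

/-- Moving from x off the line through P changes the direction of u. So a radial germ already
contains the data needed by `radial`, and it cannot also be parallel, which is the use of `p`. -/
theorem exists_linearIndependent_of_radial (hE : 3 ≤ Module.finrank ℝ E) (h : CoplanarOn u B)
    {x P : E} (hx : x ∈ B) (hP : ∀ᶠ y in 𝓝 x, u y ∈ Submodule.span ℝ {y - P})
    {p : E → Prop} (hp : ∀ᶠ y in 𝓝 x, p y) :
    ∃ y ∈ B, ∃ z ∈ B, LinearIndependent ℝ ![u y, u z] ∧ y - P ∈ Submodule.span ℝ {u y} ∧
      z - P ∈ Submodule.span ℝ {u z} ∧ p y ∧ p z := by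
  obtain ⟨w, hw⟩ := exists_notMem_span_pair hE (x - P) (x - P)
  rw [Set.pair_eq_singleton] at hw
  have hline : Tendsto (fun t : ℝ => x + t • w) (𝓝[≠] 0) (𝓝 x) := by
    have : Continuous fun t : ℝ => x + t • w := by fun_prop
    simpa using (this.tendsto 0).mono_left nhdsWithin_le_nhds
  obtain ⟨t, ⟨htB, htP, htp⟩, ht0⟩ := ((hline.eventually ((h.isOpen.eventually_mem hx).and
    (hP.and hp))).and self_mem_nhdsWithin).exists
  have ht0 : t ≠ 0 := ht0
  have main : ∀ y ∈ B, u y ∈ Submodule.span ℝ {y - P} → ∃ c : ℝ, c ≠ 0 ∧ c • (y - P) = u y := by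
    intro y hy hyP
    obtain ⟨c, hc⟩ := Submodule.mem_span_singleton.1 hyP
    refine ⟨c, ?_, hc⟩
    rintro rfl
    exact h.ne_zero y hy (by rw [← hc, zero_smul])
  obtain ⟨c, hc0, hc⟩ := main x hx hP.self_of_nhds
  obtain ⟨d, hd0, hd⟩ := main _ htB htP
  refine ⟨x, hx, _, htB, ?_, ?_, ?_, hp.self_of_nhds, htp⟩
  · rw [LinearIndependent.pair_iff' (h.ne_zero x hx)]
    intro k hk
    refine hw (Submodule.mem_span_singleton.2 ⟨(d * t)⁻¹ * (k * c - d), ?_⟩)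
    rw [← hc, ← hd] at hk
    have h1 : (d * t) • w = (k * c - d) • (x - P) := by linear_combination (norm := module) -hk
    rw [mul_smul, ← h1, inv_smul_smul₀ (mul_ne_zero hd0 ht0)]
  · exact Submodule.mem_span_singleton.2 ⟨c⁻¹, by rw [← hc, inv_smul_smul₀ hc0]⟩
  · exact Submodule.mem_span_singleton.2 ⟨d⁻¹, by rw [← hd, inv_smul_smul₀ hd0]⟩

theorem radial_or_parallel [FiniteDimensional ℝ E] (hE : 3 ≤ Module.finrank ℝ E)
    (h : CoplanarOn u B) :
    (∃ P, ∀ x ∈ B, u x ∈ Submodule.span ℝ {x - P}) ∨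
      ∀ x ∈ B, ∀ y ∈ B, u x ∈ Submodule.span ℝ {u y} := by
  by_cases hli : ∃ y ∈ B, ∃ z ∈ B, LinearIndependent ℝ ![u y, u z]
  · obtain ⟨y, hy, z, hz, hli⟩ := hli
    obtain ⟨P, hyP, hzP⟩ := h.exists_center hy hz hli
    exact Or.inl ⟨P, fun x hx => h.radial hE hy hz hli hyP hzP hx⟩
  · push Not at hli
    refine Or.inr fun x hx y hy => ?_
    have := hli y hy x hx
    rw [LinearIndependent.pair_iff' (h.ne_zero y hy)] at this
    push Not at this
    exact Submodule.mem_span_singleton.2 this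

theorem radial_of_eventually [FiniteDimensional ℝ E] (hE : 3 ≤ Module.finrank ℝ E)
    (h : CoplanarOn u B) {x P : E} (hx : x ∈ B)
    (hP : ∀ᶠ y in 𝓝 x, u y ∈ Submodule.span ℝ {y - P}) {x' : E} (hx' : x' ∈ B) :
    u x' ∈ Submodule.span ℝ {x' - P} := by
  obtain ⟨y, hy, z, hz, hli, hyP, hzP, -⟩ :=
    h.exists_linearIndependent_of_radial hE hx hP (p := fun _ => True) (by simp)
  exact h.radial hE hy hz hli hyP hzP hx'

theorem parallel_of_eventually [FiniteDimensional ℝ E] (hE : 3 ≤ Module.finrank ℝ E)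
    (h : CoplanarOn u B) {x ξ : E} (hx : x ∈ B)
    (hξ : ∀ᶠ y in 𝓝 x, u y ∈ Submodule.span ℝ {ξ}) {x' : E} (hx' : x' ∈ B) :
    u x' ∈ Submodule.span ℝ {ξ} := by
  rcases h.radial_or_parallel hE with ⟨P, hP⟩ | hpar
  · obtain ⟨y, hy, z, hz, hli, -, -, hyξ, hzξ⟩ :=
      h.exists_linearIndependent_of_radial hE hx
        (by filter_upwards [h.isOpen.mem_nhds hx] using hP) hξ
    rw [LinearIndependent.pair_iff] at hli
    obtain ⟨a, ha⟩ := Submodule.mem_span_singleton.1 hyξ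
    obtain ⟨b, hb⟩ := Submodule.mem_span_singleton.1 hzξ
    have h0 := hli b (-a) (by rw [← ha, ← hb]; module)
    rw [h0.1, zero_smul] at hb
    exact absurd hb.symm (h.ne_zero z hz)
  · exact (Submodule.span_singleton_le_iff_mem _ _).2 hξ.self_of_nhds (hpar x' hx' x hx)

end CoplanarOn

/-- A vector field whose lines are locally pairwise coplanar is radial about a single point, or has
a single direction, near a preconnected set. -/
theorem radial_or_parallel_of_isPreconnected [FiniteDimensional ℝ E]
    (hE : 3 ≤ Module.finrank ℝ E) {u : E → E} {S : Set E} (hS : IsPreconnected S)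
    (h : ∀ x ∈ S, ∃ B, x ∈ B ∧ CoplanarOn u B) {x₀ : E} (hx₀ : x₀ ∈ S) :
    (∃ P, ∀ x ∈ S, ∀ᶠ y in 𝓝 x, u y ∈ Submodule.span ℝ {y - P}) ∨
      ∀ x ∈ S, ∀ᶠ y in 𝓝 x, u y ∈ Submodule.span ℝ {u x₀} := by
  -- Each germ property at one point of B holds at every point of B, so its validity is locally
  -- constant along S.
  have key : ∀ x ∈ S, (∀ P, (∀ᶠ y in 𝓝 x₀, u y ∈ Submodule.span ℝ {y - P}) ↔
      ∀ᶠ y in 𝓝 x, u y ∈ Submodule.span ℝ {y - P}) ∧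
      (∀ ξ, (∀ᶠ y in 𝓝 x₀, u y ∈ Submodule.span ℝ {ξ}) ↔
        ∀ᶠ y in 𝓝 x, u y ∈ Submodule.span ℝ {ξ}) := by
    intro x hx
    refine hS.induction₂ (fun a b => (∀ P, (∀ᶠ y in 𝓝 a, u y ∈ Submodule.span ℝ {y - P}) ↔
      ∀ᶠ y in 𝓝 b, u y ∈ Submodule.span ℝ {y - P}) ∧
      (∀ ξ, (∀ᶠ y in 𝓝 a, u y ∈ Submodule.span ℝ {ξ}) ↔
        ∀ᶠ y in 𝓝 b, u y ∈ Submodule.span ℝ {ξ})) ?_ ?_ ?_ hx₀ hx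
    · intro a ha
      obtain ⟨B, haB, hB⟩ := h a ha
      filter_upwards [mem_nhdsWithin_of_mem_nhds (hB.isOpen.mem_nhds haB)] with b hbB
      have hev : ∀ {c}, c ∈ B → ∀ {p : E → Prop}, (∀ y ∈ B, p y) → ∀ᶠ y in 𝓝 c, p y :=
        fun hc _ hp => by filter_upwards [hB.isOpen.mem_nhds hc] using hp
      exact ⟨fun P => ⟨fun H => hev hbB fun _ => hB.radial_of_eventually hE haB H,
        fun H => hev haB fun _ => hB.radial_of_eventually hE hbB H⟩,
        fun P => ⟨fun H => hev hbB fun _ => hB.parallel_of_eventually hE haB H,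
        fun H => hev haB fun _ => hB.parallel_of_eventually hE hbB H⟩⟩
    · intro a b c _ _ _ h₁ h₂
      exact ⟨fun P => (h₁.1 P).trans (h₂.1 P), fun ξ => (h₁.2 ξ).trans (h₂.2 ξ)⟩
    · intro a b _ _ h₁
      exact ⟨fun P => (h₁.1 P).symm, fun ξ => (h₁.2 ξ).symm⟩
  obtain ⟨B, hx₀B, hB⟩ := h x₀ hx₀
  rcases hB.radial_or_parallel hE with ⟨P, hP⟩ | hpar
  · exact Or.inl ⟨P, fun x hx => ((key x hx).1 P).1
      (by filter_upwards [hB.isOpen.mem_nhds hx₀B] using hP)⟩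
  · exact Or.inr fun x hx => ((key x hx).2 _).1
      (by filter_upwards [hB.isOpen.mem_nhds hx₀B] with y hy using hpar y hy x₀ hx₀B)

end CoplanarLines

/-! ### Gluing one-variable factorizations -/

theorem exists_isIntervalDiffeo {f : ℝ → ℝ} {r : ℝ} (hf : ∀ᶠ t in 𝓝 r, ContDiffAt ℝ ∞ f t)
    (hf' : deriv f r ≠ 0) : ∃ I, IsIntervalDiffeo f I ∧ r ∈ I := by
  have hr := hf.self_of_nhds
  have hd : HasDerivAt f (deriv f r) r := (hr.differentiableAt (by simp)).hasDerivAt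
  have hfd : HasFDerivAt f
      (ContinuousLinearEquiv.unitsEquivAut ℝ (Units.mk0 _ hf') : ℝ →L[ℝ] ℝ) r := by
    have h1 : (ContinuousLinearEquiv.unitsEquivAut ℝ (Units.mk0 _ hf') : ℝ →L[ℝ] ℝ) =
        ContinuousLinearMap.toSpanSingleton ℝ (deriv f r) := by ext; simp
    rw [h1]
    exact hd.hasFDerivAt
  let e := hr.toOpenPartialHomeomorph f hfd (by simp)
  have he : ∀ t, e t = f t := fun t => rfl
  have hre : r ∈ e.source := hr.mem_toOpenPartialHomeomorph_source hfd (by simp)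
  have hcont : ContinuousAt (deriv f) r := by
    have h1 : ContDiffAt ℝ 1 f r := hr.of_le (by simp)
    have h2 : ContinuousAt (fderiv ℝ f) r := h1.continuousAt_fderiv (by simp)
    have : deriv f = fun t => fderiv ℝ f t 1 := by ext t; simp
    rw [this]
    exact h2.clm_apply continuousAt_const
  -- On an interval where f is smooth and f' ≠ 0, the local inverse is smooth at every image point,
  -- not only at f r.
  obtain ⟨δ, hδ, hI⟩ := Metric.eventually_nhds_iff_ball.1
    ((e.open_source.eventually_mem hre).and (hf.and (hcont.eventually_ne hf')))
  rw [Real.ball_eq_Ioo] at hI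
  have hsub : Ioo (r - δ) (r + δ) ⊆ e.source := fun t ht => (hI t ht).1
  refine ⟨Ioo (r - δ) (r + δ), ⟨isOpen_Ioo, ordConnected_Ioo, e '' Ioo (r - δ) (r + δ), e.symm,
    e.isOpen_image_of_subset_source isOpen_Ioo hsub,
    fun t ht => (hI t ht).2.1.contDiffWithinAt, ?_, fun t ht => ⟨t, ht, rfl⟩, ?_,
    fun t ht => e.left_inv (hsub ht), ?_⟩, by constructor <;> linarith⟩
  · rintro _ ⟨t, ht, rfl⟩
    have hinv := e.left_inv (hsub ht)
    refine (e.contDiffAt_symm_deriv (hI t ht).2.2 (e.map_source (hsub ht)) ?_ ?_).contDiffWithinAt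
    · rw [hinv]
      exact ((hI t ht).2.1.differentiableAt (by simp)).hasDerivAt
    · rw [hinv]
      exact (hI t ht).2.1
  · rintro _ ⟨t, ht, rfl⟩
    rwa [e.left_inv (hsub ht)]
  · rintro _ ⟨t, ht, rfl⟩
    rw [e.left_inv (hsub ht), he]

/-- Near `x`, `ψ` is a smooth function of `ρ` with nonzero derivative, and `ρ` is open at `x`. -/
structure FactorsAt {E : Type*} [TopologicalSpace E] (ψ ρ : E → ℝ) (x : E) (f : ℝ → ℝ) : Prop where
  contDiffAt : ∀ᶠ t in 𝓝 (ρ x), ContDiffAt ℝ ∞ f t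
  deriv_ne_zero : deriv f (ρ x) ≠ 0
  eventually_eq : ∀ᶠ y in 𝓝 x, ψ y = f (ρ y)
  nhds_le_map : 𝓝 (ρ x) ≤ map ρ (𝓝 x)

/-- Local factorizations `ψ = f ∘ ρ` near the points of a connected part of a level set of `ψ`
are restrictions of a single one. -/
theorem exists_isIntervalDiffeo_of_isPreconnected {E : Type*} [TopologicalSpace E] {ψ ρ : E → ℝ}
    (hρ : Continuous ρ) {S : Set E} (hS : IsPreconnected S) {α : ℝ} (hα : ∀ x ∈ S, ψ x = α)
    (hloc : ∀ x ∈ S, ∃ f, FactorsAt ψ ρ x f) {x₀ : E} (hx₀ : x₀ ∈ S) :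
    ∃ (W : Set E) (F : ℝ → ℝ) (I : Set ℝ), IsOpen W ∧ S ⊆ W ∧ IsIntervalDiffeo F I ∧
      ∀ x ∈ W, ρ x ∈ I ∧ ψ x = F (ρ x) := by
  have key : ∀ x ∈ S, ρ x₀ = ρ x ∧ ∀ f : ℝ → ℝ,
      (∀ᶠ y in 𝓝 x₀, ψ y = f (ρ y)) ↔ ∀ᶠ y in 𝓝 x, ψ y = f (ρ y) := by
    intro x hx
    refine hS.induction₂ (fun a b => ρ a = ρ b ∧ ∀ f : ℝ → ℝ,
      (∀ᶠ y in 𝓝 a, ψ y = f (ρ y)) ↔ ∀ᶠ y in 𝓝 b, ψ y = f (ρ y)) ?_ ?_ ?_ hx₀ hx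
    · intro a ha
      obtain ⟨g, hg⟩ := hloc a ha
      obtain ⟨I, ⟨hIo, -, J, G, -, -, -, -, -, hGF, -⟩, haI⟩ :=
        exists_isIntervalDiffeo hg.contDiffAt hg.deriv_ne_zero
      have hev := hg.eventually_eq.eventually_nhds.and
        (hρ.continuousAt.eventually (hIo.mem_nhds haI))
      filter_upwards [mem_nhdsWithin_of_mem_nhds hev, self_mem_nhdsWithin] with b ⟨hb, hbI⟩ hbS
      have hab : ρ a = ρ b := by
        refine hGF.injOn haI hbI ?_
        rw [← hg.eventually_eq.self_of_nhds, ← hb.self_of_nhds, hα a ha, hα b hbS]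
      -- Since ρ is open at c, factoring through f near c depends only on the germ of f at ρ c,
      -- which must be that of g. As ρ a = ρ b, the condition is the same at a and b.
      have hiff : ∀ c ∈ S, (∀ᶠ y in 𝓝 c, ψ y = g (ρ y)) → ∀ f : ℝ → ℝ,
          (∀ᶠ y in 𝓝 c, ψ y = f (ρ y)) ↔ ∀ᶠ t in 𝓝 (ρ c), g t = f t := by
        intro c hc hgc f
        obtain ⟨_, hcf⟩ := hloc c hc
        constructor
        · intro h
          refine hcf.nhds_le_map (show ∀ᶠ y in 𝓝 c, g (ρ y) = f (ρ y) from ?_)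
          filter_upwards [h, hgc] with y h1 h2
          rw [← h1, h2]
        · intro h
          filter_upwards [hρ.continuousAt.eventually h, hgc] with y h1 h2
          rw [h2, h1]
      exact ⟨hab, fun f => by
        rw [hiff a ha hg.eventually_eq, hiff b hbS hb, hab]⟩
    · intro a b c _ _ _ h₁ h₂
      exact ⟨h₁.1.trans h₂.1, fun f => (h₁.2 f).trans (h₂.2 f)⟩
    · intro a b _ _ h₁
      exact ⟨h₁.1.symm, fun f => (h₁.2 f).symm⟩
  obtain ⟨f, hf⟩ := hloc x₀ hx₀
  obtain ⟨I, hI, hx₀I⟩ := exists_isIntervalDiffeo hf.contDiffAt hf.deriv_ne_zero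
  refine ⟨interior {x | ρ x ∈ I ∧ ψ x = f (ρ x)}, f, I, isOpen_interior, fun x hx => ?_, hI,
    fun x hx => (interior_subset hx : x ∈ {x | ρ x ∈ I ∧ ψ x = f (ρ x)})⟩
  rw [mem_interior_iff_mem_nhds]
  obtain ⟨h₁, h₂⟩ := key x hx
  exact (hρ.continuousAt.eventually (hI.1.mem_nhds (h₁ ▸ hx₀I))).and ((h₂ f).1 hf.eventually_eq)

/-! ### Local factorization through a linear function or a distance -/

section Factorization

theorem inner_eq_zero_of_mem_span_singleton {E : Type*} [NormedAddCommGroup E]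
    [InnerProductSpace ℝ E] {a b c : E} (h : a ∈ Submodule.span ℝ {b})
    (hbc : inner ℝ b c = 0) : inner ℝ a c = 0 := by
  obtain ⟨k, rfl⟩ := Submodule.mem_span_singleton.1 h
  rw [inner_smul_left, hbc, mul_zero]

variable {E : Type*} [NormedAddCommGroup E] [InnerProductSpace ℝ E] [CompleteSpace E]

theorem fderiv_apply_eq_inner_gradient (ψ : E → ℝ) (x v : E) :
    fderiv ℝ ψ x v = inner ℝ (gradient ψ x) v := by
  simp [gradient]

theorem apply_one_eq_apply_zero_of_inner_gradient_eq_zero {ψ : E → ℝ} {c : ℝ → E}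
    (hc : ∀ s ∈ Icc (0 : ℝ) 1, DifferentiableAt ℝ ψ (c s) ∧
      ∃ c', HasDerivAt c c' s ∧ inner ℝ (gradient ψ (c s)) c' = 0) : ψ (c 1) = ψ (c 0) := by
  have hd : ∀ s ∈ Icc (0 : ℝ) 1, HasDerivAt (fun s => ψ (c s)) 0 s := by
    intro s hs
    obtain ⟨hψ, c', hc', h0⟩ := hc s hs
    have := hψ.hasFDerivAt.comp_hasDerivAt s hc'
    rwa [fderiv_apply_eq_inner_gradient, h0] at this
  exact constant_of_has_deriv_right_zero (f := fun s => ψ (c s))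
    (fun s hs => (hd s hs).continuousAt.continuousWithinAt)
    (fun s hs => (hd s ⟨hs.1, hs.2.le⟩).hasDerivWithinAt) 1 ⟨zero_le_one, le_rfl⟩

/-- A smooth local section γ of ρ through x supplies f = ψ ∘ γ, and ρ ∘ γ = id makes ρ open at x. -/
theorem FactorsAt.of_section {ψ ρ : E → ℝ} {x e : E} {γ : ℝ → E}
    (hψ : ∀ᶠ y in 𝓝 x, ContDiffAt ℝ ∞ ψ y) (hγ : ContDiff ℝ ∞ γ) (hγx : γ (ρ x) = x)
    (hργ : ∀ᶠ t in 𝓝 (ρ x), ρ (γ t) = t) (hγ' : HasDerivAt γ e (ρ x))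
    (he : inner ℝ (gradient ψ x) e ≠ 0) (h : ∀ᶠ y in 𝓝 x, ψ (γ (ρ y)) = ψ y) :
    FactorsAt ψ ρ x (ψ ∘ γ) where
  contDiffAt := by
    have h1 : Tendsto γ (𝓝 (ρ x)) (𝓝 x) := by
      simpa [hγx] using hγ.continuous.tendsto (ρ x)
    filter_upwards [h1.eventually hψ] with t ht
    exact ht.comp t hγ.contDiffAt
  deriv_ne_zero := by
    have h1 : HasFDerivAt ψ (fderiv ℝ ψ (γ (ρ x))) (γ (ρ x)) := by
      rw [hγx]
      exact (hψ.self_of_nhds.differentiableAt (by simp)).hasFDerivAt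
    rw [(h1.comp_hasDerivAt _ hγ').deriv, fderiv_apply_eq_inner_gradient, hγx]
    exact he
  eventually_eq := by
    filter_upwards [h] with y hy using hy.symm
  nhds_le_map := by
    have h1 : Tendsto γ (𝓝 (ρ x)) (𝓝 x) := by
      simpa [hγx] using hγ.continuous.tendsto (ρ x)
    have h2 : map (ρ ∘ γ) (𝓝 (ρ x)) = 𝓝 (ρ x) := by
      exact (map_congr (m₁ := ρ ∘ γ) (m₂ := id) hργ).trans map_id
    rw [← h2, ← Filter.map_map]
    exact map_mono h1

theorem exists_factorsAt_of_parallel {ψ : E → ℝ} {x ξ : E}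
    (hψ : ∀ᶠ y in 𝓝 x, ContDiffAt ℝ ∞ ψ y) (hx : gradient ψ x ≠ 0) (hξ : ‖ξ‖ = 1)
    (hpar : ∀ᶠ y in 𝓝 x, gradient ψ y ∈ Submodule.span ℝ {ξ}) :
    ∃ f, FactorsAt ψ (fun y => inner ℝ y ξ) x f := by
  have hξξ : inner ℝ ξ ξ = 1 := by rw [real_inner_self_eq_norm_sq, hξ, one_pow]
  set γ : ℝ → E := fun t => x + (t - inner ℝ x ξ) • ξ with hγ
  have hργ : ∀ t, inner ℝ (γ t) ξ = t := by
    intro t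
    simp [hγ, inner_add_left, inner_smul_left, hξ]
  have hγs : ContDiff ℝ ∞ γ := by fun_prop
  refine ⟨_, FactorsAt.of_section (e := ξ) hψ hγs (by simp [hγ])
    (Eventually.of_forall hργ) ?_ ?_ ?_⟩
  · simpa [hγ] using (((hasDerivAt_id (inner ℝ x ξ)).sub_const (inner ℝ x ξ)).smul_const ξ).const_add x
  · obtain ⟨k, hk⟩ := Submodule.mem_span_singleton.1 hpar.self_of_nhds
    rw [← hk, inner_smul_left, hξξ, mul_one]
    rintro h0
    exact hx (by rw [← hk, show k = 0 from h0, zero_smul])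
  · have hH : ∀ s ∈ Icc (0 : ℝ) 1, Tendsto
        (fun q : E × ℝ => q.1 + q.2 • (γ (inner ℝ q.1 ξ) - q.1)) (𝓝 (x, s)) (𝓝 x) := by
      intro s _
      have h1 : Continuous fun q : E × ℝ => q.1 + q.2 • (γ (inner ℝ q.1 ξ) - q.1) := by fun_prop
      convert h1.tendsto (x, s) using 2
      simp [hγ]
    -- The segment from y to the point of γ at the same height lies in a hyperplane orthogonal to ξ.
    -- It collapses to x when y = x, so by compactness it stays in the good neighbourhood for y near
    -- x.
    have htube := isCompact_Icc.eventually_forall_of_forall_eventually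
      (P := fun y s => ContDiffAt ℝ ∞ ψ (y + s • (γ (inner ℝ y ξ) - y)) ∧
        gradient ψ (y + s • (γ (inner ℝ y ξ) - y)) ∈ Submodule.span ℝ {ξ})
      (fun s hs => (hH s hs).eventually (hψ.and hpar))
    filter_upwards [htube] with y hy
    have h2 := apply_one_eq_apply_zero_of_inner_gradient_eq_zero (ψ := ψ)
      (c := fun s => y + s • (γ (inner ℝ y ξ) - y)) (fun s hs =>
        ⟨(hy s hs).1.differentiableAt (by simp), γ (inner ℝ y ξ) - y, ?_, ?_⟩)
    · simpa using h2
    · simpa using ((hasDerivAt_id s).smul_const (γ (inner ℝ y ξ) - y)).const_add y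
    · refine inner_eq_zero_of_mem_span_singleton (hy s hs).2 ?_
      rw [inner_sub_right, real_inner_comm, hργ, real_inner_comm, sub_self]

theorem exists_factorsAt_of_radial {ψ : E → ℝ} {x P : E}
    (hψ : ∀ᶠ y in 𝓝 x, ContDiffAt ℝ ∞ ψ y) (hx : gradient ψ x ≠ 0)
    (hrad : ∀ᶠ y in 𝓝 x, gradient ψ y ∈ Submodule.span ℝ {y - P}) :
    ∃ f, FactorsAt ψ (fun y => ‖y - P‖) x f := by
  obtain ⟨k, hk⟩ := Submodule.mem_span_singleton.1 hrad.self_of_nhds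
  have hk0 : k ≠ 0 := by
    rintro rfl
    exact hx (by rw [← hk, zero_smul])
  have hxP : x - P ≠ 0 := by
    intro h0
    exact hx (by rw [← hk, h0, smul_zero])
  have hr : 0 < ‖x - P‖ := norm_pos_iff.2 hxP
  set e : E := ‖x - P‖⁻¹ • (x - P) with he
  have hen : ‖e‖ = 1 := norm_smul_inv_norm hxP
  set γ : ℝ → E := fun t => P + t • e with hγ
  have hγx : γ ‖x - P‖ = x := by
    simp [hγ, he, smul_inv_smul₀ hr.ne']
  have hγs : ContDiff ℝ ∞ γ := by fun_prop
  refine ⟨_, FactorsAt.of_section (e := e) hψ hγs hγx ?_ ?_ ?_ ?_⟩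
  · filter_upwards [lt_mem_nhds hr] with t ht
    simp [hγ, norm_smul, hen, abs_of_pos ht]
  · simpa [hγ] using ((hasDerivAt_id ‖x - P‖).smul_const e).const_add P
  · rw [← hk, he, inner_smul_left, inner_smul_right, real_inner_self_eq_norm_sq]
    have := hr.ne'
    simp only [conj_trivial]
    positivity
  -- H moves y to the ray from P through x along the sphere about P: the straight segment from y - P
  -- to x - P is rescaled to norm ‖y - P‖.
  · set z : E → ℝ → E := fun y s => (y - P) + s • (x - y) with hz
    set H : E × ℝ → E := fun q => P + (‖q.1 - P‖ * ‖z q.1 q.2‖⁻¹) • z q.1 q.2 with hHdef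
    have hzc : Continuous fun q : E × ℝ => z q.1 q.2 := by fun_prop
    have hzx : ∀ s, z x s = x - P := by simp [hz]
    have hz0 : ∀ s ∈ Icc (0 : ℝ) 1, ∀ᶠ q in 𝓝 (x, s), z q.1 q.2 ≠ 0 := by
      intro s _
      exact hzc.continuousAt.eventually_ne (by simpa [hzx] using hxP)
    have hH : ∀ s ∈ Icc (0 : ℝ) 1, Tendsto H (𝓝 (x, s)) (𝓝 x) := by
      intro s _
      have h1 : ContinuousAt H (x, s) := by
        refine continuousAt_const.add (((by fun_prop : Continuous fun q : E × ℝ =>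
          ‖q.1 - P‖).continuousAt.mul (hzc.norm.continuousAt.inv₀ ?_)).smul hzc.continuousAt)
        simpa [hzx] using hxP
      have h2 : H (x, s) = x := by simp [hHdef, hzx, mul_inv_cancel₀ hr.ne']
      rw [ContinuousAt, h2] at h1
      exact h1
    have htube := isCompact_Icc.eventually_forall_of_forall_eventually
      (P := fun y s => (ContDiffAt ℝ ∞ ψ (H (y, s)) ∧
        gradient ψ (H (y, s)) ∈ Submodule.span ℝ {H (y, s) - P}) ∧ z y s ≠ 0)
      (fun s hs => ((hH s hs).eventually (hψ.and hrad)).and (hz0 s hs))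
    filter_upwards [htube] with y hy
    have h0 : z y 0 = y - P := by simp [hz]
    have h1 : z y 1 = x - P := by simp [hz]
    have hyP : ‖y - P‖ ≠ 0 := by
      rw [← h0, norm_ne_zero_iff]
      exact (hy 0 ⟨le_rfl, zero_le_one⟩).2
    have hzd : Differentiable ℝ (z y) := by fun_prop
    have hd : ∀ s ∈ Icc (0 : ℝ) 1,
        HasDerivAt (fun s => H (y, s)) (deriv (fun s => H (y, s)) s) s := by
      intro s hs
      have hzs : DifferentiableAt ℝ (z y) s := hzd s
      have hne := (hy s hs).2
      exact ((((hzs.norm ℝ hne).inv (norm_ne_zero_iff.2 hne)).const_mul ‖y - P‖).smul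
        hzs |>.const_add P).hasDerivAt
    -- Differentiating the constant ‖H - P‖² shows that the velocity is tangent to the sphere.
    have horth : ∀ s ∈ Icc (0 : ℝ) 1,
        inner ℝ (H (y, s) - P) (deriv (fun s => H (y, s)) s) = 0 := by
      intro s hs
      have h3 := ((hd s hs).sub_const P).norm_sq
      have h4 : (fun s => ‖H (y, s) - P‖ ^ 2) =ᶠ[𝓝 s] fun _ => ‖y - P‖ ^ 2 := by
        filter_upwards [hzd.continuous.continuousAt.eventually_ne (hy s hs).2] with s' hs'
        simp [hHdef, norm_smul, mul_assoc, inv_mul_cancel₀ (norm_ne_zero_iff.2 hs')]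
      have h5 := h3.unique ((hasDerivAt_const s _).congr_of_eventuallyEq h4)
      linarith
    have h2 := apply_one_eq_apply_zero_of_inner_gradient_eq_zero (ψ := ψ)
      (c := fun s => H (y, s)) (fun s hs =>
        ⟨(hy s hs).1.1.differentiableAt (by simp), deriv (fun s => H (y, s)) s, ?_, ?_⟩)
    · convert h2 using 2
      · simp [hHdef, h1, hγ, he, mul_smul]
      · simp [hHdef, h0, mul_inv_cancel₀ hyP]
    · exact hd s hs
    · exact inner_eq_zero_of_mem_span_singleton (hy s hs).1.2 (horth s hs)

end Factorization

/-! ### Application to u = ∇ψ -/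

theorem ContDiffOn.continuousOn_gradient {E : Type*} [NormedAddCommGroup E]
    [InnerProductSpace ℝ E] [CompleteSpace E] {ψ : E → ℝ} {Ω : Set E} (hΩ : IsOpen Ω)
    (hψ : ContDiffOn ℝ ∞ ψ Ω) : ContinuousOn (fun x => gradient ψ x) Ω :=
  (InnerProductSpace.toDual ℝ E).symm.continuous.comp_continuousOn
    (hψ.continuousOn_fderiv_of_isOpen hΩ (by simp))

theorem KineticFormulation.exists_coplanarOn {N : ℕ} {Ω : Set (EuclideanSpace ℝ (Fin N))}
    (hΩ : IsOpen Ω) {u : EuclideanSpace ℝ (Fin N) → EuclideanSpace ℝ (Fin N)}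
    (hu : ContinuousOn u Ω) (hkin : KineticFormulation Ω u) {x : EuclideanSpace ℝ (Fin N)}
    (hx : x ∈ Ω) (hux : u x ≠ 0) : ∃ B, x ∈ B ∧ CoplanarOn u B := by
  obtain ⟨ε, hε, h⟩ := Metric.eventually_nhds_iff_ball.1 ((hΩ.eventually_mem hx).and
    ((hu.continuousAt (hΩ.mem_nhds hx)).eventually_ne hux))
  exact ⟨Metric.ball x ε, Metric.mem_ball_self hε, Metric.isOpen_ball,
    hu.mono fun y hy => (h y hy).1, fun y hy => (h y hy).2, fun y hy z hz =>
      hkin.mem_span_pair hΩ hu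
        (((convex_ball x ε).segment_subset hy hz).trans fun w hw => (h w hw).1)⟩

theorem corollary3p5 (N : ℕ) (hN : 3 ≤ N)
    (Ω : Set (EuclideanSpace ℝ (Fin N))) (hΩ : IsOpen Ω)
    (ψ : EuclideanSpace ℝ (Fin N) → ℝ) (hψ : ContDiffOn ℝ ∞ ψ Ω)
    (hkin : KineticFormulation Ω (fun x => gradient ψ x))
    (α : ℝ) (hα : ∀ x ∈ Ω, ψ x = α → gradient ψ x ≠ 0)
    (S : Set (EuclideanSpace ℝ (Fin N)))
    (hS : ∃ x₀ ∈ {x ∈ Ω | ψ x = α}, S = connectedComponentIn {x ∈ Ω | ψ x = α} x₀) :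
    ∃ (W : Set (EuclideanSpace ℝ (Fin N))) (F : ℝ → ℝ) (I : Set ℝ),
      IsOpen W ∧ S ⊆ W ∧ W ⊆ Ω ∧ IsIntervalDiffeo F I ∧
        ((∃ P : EuclideanSpace ℝ (Fin N), ∀ x ∈ W, ‖x - P‖ ∈ I ∧ ψ x = F ‖x - P‖) ∨
          (∃ ξ : EuclideanSpace ℝ (Fin N), ‖ξ‖ = 1 ∧
            ∀ x ∈ W, inner ℝ x ξ ∈ I ∧ ψ x = F (inner ℝ x ξ))) := by
  obtain ⟨x₀, hx₀, rfl⟩ := hS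
  have hx₀S := mem_connectedComponentIn hx₀
  have hSpre := isPreconnected_connectedComponentIn (F := {x ∈ Ω | ψ x = α}) (x := x₀)
  have hSsub := connectedComponentIn_subset {x ∈ Ω | ψ x = α} x₀
  set S := connectedComponentIn {x ∈ Ω | ψ x = α} x₀
  have hgrad : ∀ x ∈ S, gradient ψ x ≠ 0 := fun x hx => hα x (hSsub hx).1 (hSsub hx).2
  have hsmooth : ∀ x ∈ S, ∀ᶠ y in 𝓝 x, ContDiffAt ℝ ∞ ψ y := fun x hx => by
    filter_upwards [hΩ.mem_nhds (hSsub hx).1] with y hy using hψ.contDiffAt (hΩ.mem_nhds hy)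
  rcases radial_or_parallel_of_isPreconnected (by simpa using hN) hSpre
    (fun x hx => hkin.exists_coplanarOn hΩ (hψ.continuousOn_gradient hΩ) (hSsub hx).1
      (hgrad x hx)) hx₀S with ⟨P, hP⟩ | hpar
  · obtain ⟨W, F, I, hW, hSW, hI, h⟩ := exists_isIntervalDiffeo_of_isPreconnected
      (ρ := fun x => ‖x - P‖) (by fun_prop) hSpre (fun x hx => (hSsub hx).2)
      (fun x hx => exists_factorsAt_of_radial (hsmooth x hx) (hgrad x hx) (hP x hx)) hx₀S
    exact ⟨W ∩ Ω, F, I, hW.inter hΩ, fun x hx => ⟨hSW hx, (hSsub hx).1⟩, inter_subset_right, hI,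
      Or.inl ⟨P, fun x hx => h x hx.1⟩⟩
  · have hu₀ := hgrad x₀ hx₀S
    set ξ := ‖gradient ψ x₀‖⁻¹ • gradient ψ x₀ with hξ
    have hξ1 : ‖ξ‖ = 1 := norm_smul_inv_norm hu₀
    have hspan : Submodule.span ℝ {ξ} = Submodule.span ℝ {gradient ψ x₀} :=
      Submodule.span_singleton_smul_eq (IsUnit.mk0 _ (inv_ne_zero (norm_ne_zero_iff.2 hu₀))) _
    rw [← hspan] at hpar
    obtain ⟨W, F, I, hW, hSW, hI, h⟩ := exists_isIntervalDiffeo_of_isPreconnected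
      (ρ := fun x => inner ℝ x ξ) (by fun_prop) hSpre (fun x hx => (hSsub hx).2)
      (fun x hx => exists_factorsAt_of_parallel (hsmooth x hx) (hgrad x hx) hξ1 (hpar x hx)) hx₀S
    exact ⟨W ∩ Ω, F, I, hW.inter hΩ, fun x hx => ⟨hSW hx, (hSsub hx).1⟩, inter_subset_right, hI,
      Or.inr ⟨ξ, hξ1, fun x hx => h x hx.1⟩⟩
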